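/- **Theorem 4.2 (cf. Matos, Thm 3.10).** Let $E$ be a complex Banach space with an unconditional Schauder basis $(e_i)_{i\in I}$ ($I$ countable, possibly finite), with coordinate functionals $z\mapsto z_i$. Give $E$ its coordinatewise lattice structure: $E_{\mathbb R}$ is the real subspace of vectors with real coordinates, a vector of $E_{\mathbb R}$ is positive if its coordinates are all $\ge 0$, and $|z|=\sum_i|z_i|e_i$ for $z\in E$. *Regular polynomials.* An $m$-homogeneous polynomial $P(x)=A(x,\dots,x)$ on $E_{\mathbb R}$ (with $A$ a symmetric real $m$-linear form) is positive if $A(x_1,\dots,x_m)\ge 0$ for all positive $x_1,\dots,x_m$, it is regular if it is a difference of two positive $m$-homogeneous polynomials, and $P\le Q$ means that $Q-P$ is positive. A complex $m$-homogeneous polynomial $P$ on $E$, with symmetric $m$-linear form $A$, is regular if the polynomials $P_0,P_1$ on $E_{\mathbb R}$ given by the forms $\operatorname{Re}A$ and $\operatorname{Im}A$ restricted to $E_{\mathbb R}^m$ are regular. Its modulus $|P|$ is then $\sup_{\theta\in\mathbb R}(\cos\theta\,P_0+\sin\theta\,P_1)$, the supremum being taken in the ordered space of regular $m$-homogeneous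 polynomials on $E_{\mathbb R}$. *Regularly holomorphic functions.* Let $U\subseteq E$ be open. A function $f\colon U\to\mathbb C$ is regularly holomorphic if (a) $f$ is holomorphic on $U$, that is, near every point of $U$ it is the sum of a power series of continuous homogeneous polynomials; (b) for every $z\in U$ and $m\ge 0$, the $m$-th Taylor polynomial $P_{m,z}=\frac{1}{m!}\widehat{d}^{\,m}f(z)$ is regular; (c) for every $z\in U$, the Taylor series of $f$ at $z$ is regularly convergent in some neighbourhood of $z$, that is, $\sum_{m}|P_{m,z}|(|w-z|)<\infty$ for all $w$ in a neighbourhood of $z$. Then $f\colon U\to\mathbb C$ is regularly holomorphic if and only if, for every $z\in U$, there are coefficients $c_\alpha\in\mathbb C$, indexed by the multi-indices $\alpha\in\mathbb N_0^{(I)}$ of finite support, such that for all $w$ in some neighbourhood of $z$ the monomial expansion $\sum_{\alpha} c_\alpha (w-z)^\alpha$, where $v^\alpha=\prod_i v_i^{\alpha_i}$, converges absolutely with sum $f(w)$. -/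

import Mathlib

open scoped Topology

namespace RegularHolomorphy

section

variable {ι E : Type*} [NormedAddCommGroup E] [NormedSpace ℂ E]

/-! ### The lattice structure given by an unconditional basis -/

/-- The real part `E_ℝ` of `E`: the vectors all of whose coordinates are real. -/
def realPart (b : UnconditionalSchauderBasis ι ℂ E) : Submodule ℝ E where
  carrier := {x | ∀ i, (b.coord i x).im = 0}
  zero_mem' := fun i => by simp
  add_mem' := fun {x y} hx hy i => by
    rw [map_add, Complex.add_im, hx i, hy i, add_zero]
  smul_mem' := fun r x hx i => by
    rw [← Complex.coe_smul, map_smul, smul_eq_mul, Complex.im_ofReal_mul, hx i, mul_zero]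

/-- A real vector is positive if all its coordinates are nonnegative. -/
def IsNonneg (b : UnconditionalSchauderBasis ι ℂ E) (x : realPart b) : Prop :=
  ∀ i, 0 ≤ (b.coord i (x : E)).re

/-- A coordinate of an unconditional (formal) sum along the basis. -/
theorem coord_tsum (b : UnconditionalSchauderBasis ι ℂ E) {a : ι → ℂ}
    (h : Summable fun i => a i • b i) (j : ι) : b.coord j (∑' i, a i • b i) = a j := by
  classical
  rw [(b.coord j).map_tsum h, tsum_eq_single j]
  · simp [b.ortho]
  · intro i hi
    simp [b.ortho, hi.symm]

/-- The modulus `|z| = ∑ |z_i| e_i`, as a vector of the real part `E_ℝ`. The sum converges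
in a Banach space: see `hasSum_modulus` and `coord_modulus`. -/
noncomputable def modulus (b : UnconditionalSchauderBasis ι ℂ E) (z : E) : realPart b :=
  ⟨∑' i, (‖b.coord i z‖ : ℂ) • b i, fun j => by
    by_cases h : Summable fun i => (‖b.coord i z‖ : ℂ) • b i
    · rw [coord_tsum b h j, Complex.ofReal_im]
    · rw [tsum_eq_zero_of_not_summable h, map_zero, Complex.zero_im]⟩

/-- Multipliers in `[0, 1]` do not increase a bound on all the subsums. -/
theorem norm_add_sum_smul_le (x : ι → E) (a : ι → ℝ) (ha : ∀ i, 0 ≤ a i ∧ a i ≤ 1) (C : ℝ)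
    (s : Finset ι) : ∀ y : E, (∀ t ⊆ s, ‖y + ∑ i ∈ t, x i‖ ≤ C) →
      ‖y + ∑ i ∈ s, a i • x i‖ ≤ C := by
  classical
  induction s using Finset.induction_on with
  | empty => intro y h; simpa using h ∅ (Finset.Subset.refl _)
  | insert i s hi ih =>
    intro y h
    have h0 := ih y fun t ht => h t (ht.trans (Finset.subset_insert i s))
    have h1 := ih (y + x i) fun t ht => by
      have := h (insert i t) (Finset.insert_subset_insert i ht)
      rwa [Finset.sum_insert (fun hit => hi (ht hit)), ← add_assoc] at this
    have e : y + ∑ j ∈ insert i s, a j • x j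
        = (1 - a i) • (y + ∑ j ∈ s, a j • x j) + a i • (y + x i + ∑ j ∈ s, a j • x j) := by
      rw [Finset.sum_insert hi]; module
    rw [e]
    refine (norm_add_le _ _).trans ?_
    rw [norm_smul, norm_smul, Real.norm_of_nonneg (ha i).1,
      Real.norm_of_nonneg (sub_nonneg.2 (ha i).2)]
    nlinarith [(ha i).1, (ha i).2]

/-- An unconditionally convergent series in a Banach space stays summable after
multiplication by scalars in `[0, 1]`. -/
theorem summable_smul_of_mem_unit [CompleteSpace E] {x : ι → E} (hx : Summable x)
    (a : ι → ℝ) (ha : ∀ i, 0 ≤ a i ∧ a i ≤ 1) : Summable fun i => a i • x i := by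
  rw [summable_iff_vanishing_norm] at hx ⊢
  intro ε hε
  obtain ⟨s, hs⟩ := hx (ε / 2) (half_pos hε)
  refine ⟨s, fun t ht => ?_⟩
  have := norm_add_sum_smul_le x a ha (ε / 2) t 0 fun u hu => by
    rw [zero_add]; exact (hs u (ht.mono_left hu)).le
  rw [zero_add] at this
  linarith

/-- In a Banach space, the series defining the modulus converges unconditionally. -/
theorem hasSum_modulus [CompleteSpace E] (b : UnconditionalSchauderBasis ι ℂ E) (z : E) :
    HasSum (fun i => (‖b.coord i z‖ : ℂ) • b i) (modulus b z : E) := by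
  have hx : Summable fun i => b.coord i z • b i := (b.expansion z).summable
  let u : ι → ℂ := fun i => (starRingEnd ℂ) (b.coord i z) / ‖b.coord i z‖
  have hu : ∀ i, ‖u i‖ ≤ 1 := fun i => by
    simp only [u, norm_div, RCLike.norm_conj, Complex.norm_real, norm_norm]
    exact div_self_le_one _
  have hre : ∀ i, |(u i).re| ≤ 1 := fun i => (Complex.abs_re_le_norm _).trans (hu i)
  have him : ∀ i, |(u i).im| ≤ 1 := fun i => (Complex.abs_im_le_norm _).trans (hu i)
  have key : ∀ a : ι → ℝ, (∀ i, |a i| ≤ 1) → Summable fun i => a i • (b.coord i z • b i) := by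
    intro a ha
    have h1 := summable_smul_of_mem_unit hx (fun i => (1 + a i) / 2) fun i => by
      have := abs_le.1 (ha i); constructor <;> linarith
    have h2 := (h1.const_smul (2 : ℝ)).sub hx
    refine h2.congr fun i => ?_
    module
  have h := (key _ hre).add ((key _ him).const_smul Complex.I)
  refine (h.congr fun i => ?_).hasSum
  rw [← Complex.coe_smul, ← Complex.coe_smul, smul_smul, smul_smul, smul_smul, ← add_smul]
  congr 1
  have : ((u i).re : ℂ) + (u i).im * Complex.I = u i := Complex.re_add_im _
  symm
  calc (‖b.coord i z‖ : ℂ) = u i * b.coord i z := by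
        simp only [u]
        by_cases h0 : b.coord i z = 0
        · simp [h0]
        · have h1 : (‖b.coord i z‖ : ℂ) ≠ 0 := by simpa using h0
          rw [div_mul_eq_mul_div, eq_div_iff h1, Complex.conj_mul', sq]
    _ = ((u i).re + (u i).im * Complex.I) * b.coord i z := by rw [this]
    _ = _ := by ring

/-- The modulus is coordinatewise. -/
theorem coord_modulus [CompleteSpace E] (b : UnconditionalSchauderBasis ι ℂ E) (z : E)
    (j : ι) : b.coord j (modulus b z : E) = ‖b.coord j z‖ :=
  coord_tsum b (hasSum_modulus b z).summable j

/-! ### Homogeneous polynomials, through their symmetric multilinear forms -/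

/-- `m`-linear forms on the real Banach lattice `E_ℝ`. -/
abbrev RealForm (b : UnconditionalSchauderBasis ι ℂ E) (m : ℕ) :=
  MultilinearMap ℝ (fun _ : Fin m => realPart b) ℝ

/-- Symmetric `m`-linear forms; they correspond to `m`-homogeneous polynomials. -/
def IsSymmetric {b : UnconditionalSchauderBasis ι ℂ E} {m : ℕ} (A : RealForm b m) : Prop :=
  ∀ (σ : Equiv.Perm (Fin m)) (x : Fin m → realPart b), A (fun j => x (σ j)) = A x

/-- The polynomial `x ↦ A(x, …, x)` is positive: `A(x₁, …, x_m) ≥ 0` whenever all the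
`x_j` are positive. -/
def IsPositive {b : UnconditionalSchauderBasis ι ℂ E} {m : ℕ} (A : RealForm b m) : Prop :=
  IsSymmetric A ∧ ∀ x : Fin m → realPart b, (∀ j, IsNonneg b (x j)) → 0 ≤ A x

/-- A real polynomial is regular if it is the difference of two positive polynomials. -/
def IsRegularReal {b : UnconditionalSchauderBasis ι ℂ E} {m : ℕ} (A : RealForm b m) : Prop :=
  ∃ B C : RealForm b m, IsPositive B ∧ IsPositive C ∧ A = B - C

/-- The real part `A₀` of a complex `m`-linear form: `A₀(x) = Re A(x)` for real arguments. -/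
noncomputable def reForm (b : UnconditionalSchauderBasis ι ℂ E) {m : ℕ}
    (A : MultilinearMap ℂ (fun _ : Fin m => E) ℂ) : RealForm b m :=
  Complex.reLm.compMultilinearMap
    ((A.restrictScalars ℝ).compLinearMap fun _ => (realPart b).subtype)

/-- The imaginary part `A₁` of a complex `m`-linear form: `A₁(x) = Im A(x)` for real
arguments. -/
noncomputable def imForm (b : UnconditionalSchauderBasis ι ℂ E) {m : ℕ}
    (A : MultilinearMap ℂ (fun _ : Fin m => E) ℂ) : RealForm b m :=
  Complex.imLm.compMultilinearMap
    ((A.restrictScalars ℝ).compLinearMap fun _ => (realPart b).subtype)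

/-- A complex polynomial is regular if its real and imaginary parts are regular. -/
def IsRegular (b : UnconditionalSchauderBasis ι ℂ E) {m : ℕ}
    (A : MultilinearMap ℂ (fun _ : Fin m => E) ℂ) : Prop :=
  IsRegularReal (reForm b A) ∧ IsRegularReal (imForm b A)

/-- `Q` is the modulus of the regular polynomial `P` with symmetric form `A = A₀ + i A₁`:
in the ordered space of regular real polynomials (where `B ≤ C` means that `C - B` is
positive), `Q` is the supremum of the polynomials `cos θ A₀ + sin θ A₁`. -/
structure IsModulus (b : UnconditionalSchauderBasis ι ℂ E) {m : ℕ}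
    (A : MultilinearMap ℂ (fun _ : Fin m => E) ℂ) (Q : RealForm b m) : Prop where
  regular : IsRegularReal Q
  upper : ∀ θ : ℝ, IsPositive (Q - (Real.cos θ • reForm b A + Real.sin θ • imForm b A))
  least : ∀ R : RealForm b m, IsRegularReal R →
    (∀ θ : ℝ, IsPositive (R - (Real.cos θ • reForm b A + Real.sin θ • imForm b A))) →
    IsPositive (R - Q)

/-- The power series `∑ P_m`, where `P_m` has symmetric form `A m`, is regularly convergent
at `v`: the series `∑ |P_m|(|v|)` (of nonnegative reals) converges. -/
def RegularlyConvergentAt (b : UnconditionalSchauderBasis ι ℂ E)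
    (A : ∀ m : ℕ, MultilinearMap ℂ (fun _ : Fin m => E) ℂ) (v : E) : Prop :=
  ∃ Q : ∀ m : ℕ, RealForm b m, (∀ m, IsModulus b (A m) (Q m)) ∧
    Summable fun m => Q m fun _ => modulus b v

/-! ### Regularly holomorphic functions and monomial expansions -/

/-- The symmetric `m`-linear form of the `m`-th Taylor polynomial of `f` at `z`. -/
noncomputable def taylorForm (f : E → ℂ) (z : E) (m : ℕ) :
    MultilinearMap ℂ (fun _ : Fin m => E) ℂ :=
  ((m.factorial : ℂ)⁻¹ • iteratedFDeriv ℂ m f z).toMultilinearMap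

/-- `f` is regularly holomorphic on `U`. Holomorphic means: locally the sum of a power series
of continuous homogeneous polynomials. -/
structure RegularlyHolomorphicOn (b : UnconditionalSchauderBasis ι ℂ E)
    (f : E → ℂ) (U : Set E) : Prop where
  holomorphic : AnalyticOnNhd ℂ f U
  regular : ∀ z ∈ U, ∀ m : ℕ, IsRegular b (taylorForm f z m)
  convergent : ∀ z ∈ U, ∀ᶠ w in 𝓝 z, RegularlyConvergentAt b (taylorForm f z) (w - z)

/-- The monomial `z^α = ∏ z_i^{α_i}` in the coordinates of `z`. -/
noncomputable def monomial (b : UnconditionalSchauderBasis ι ℂ E) (α : ι →₀ ℕ) (z : E) : ℂ :=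
  α.prod fun i k => b.coord i z ^ k

/-- In some neighbourhood of `z`, the function `f` is the sum of an absolutely convergent
monomial expansion `f(w) = ∑ c_α (w - z)^α` around `z`. -/
def HasAbsMonomialExpansionAt (b : UnconditionalSchauderBasis ι ℂ E)
    (f : E → ℂ) (z : E) : Prop :=
  ∃ c : (ι →₀ ℕ) → ℂ, ∀ᶠ w in 𝓝 z,
    Summable (fun α => ‖c α * monomial b α (w - z)‖) ∧
    HasSum (fun α => c α * monomial b α (w - z)) (f w)

end

end RegularHolomorphy

/-! Everything is expressed through coefficients on words. An `m`-linear form `A` has the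
coefficients `A(e_{i_1}, …, e_{i_m})`, and a multi-index is a word up to the order of its letters.
Both sides of the equivalence say that the series over all words of all lengths converges absolutely
near `z`.

For one continuous symmetric form, regularity amounts to absolute summability of its coefficients at
every vector (`IsRegular.isAbsSummable`, `isRegular_of_isAbsSummable`). A positive form dominates
the finite sums of its own expansion, even without continuity (`IsPositive.sum_le`). Hence the
modulus of `A` is the form whose coefficients are the absolute values of those of `A`
(`isModulus_absForm`), and regular convergence is absolute convergence over words
(`regularlyConvergentAt_iff`). Grouping words into multi-indices then gives the forward implication.

The converse must also produce holomorphy. Each `c_α` is split equally among its finitely many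
words. Pointwise absolute convergence near `0` upgrades to a uniform bound on a ball: a sequence of
bad points could be dominated coordinatewise by a single small vector (`exists_tsum_words_le`). A
polarization inequality for nonnegative coefficients turns this bound into geometric norm bounds on
the homogeneous forms (`exists_norm_seriesForm_le`). So they make up a convergent power series, and
symmetry identifies them with the Taylor forms. -/

open scoped Topology

namespace RegularHolomorphy

section

variable {ι E : Type*} [NormedAddCommGroup E] [NormedSpace ℂ E]

/-! ### The modulus -/

/-- Complex multipliers of modulus at most one act on finite sums along the basis in a uniformly
bounded way. -/
theorem exists_norm_sum_multiplier_le [CompleteSpace E] (b : UnconditionalSchauderBasis ι ℂ E) :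
    ∃ K : ℝ, 0 < K ∧ ∀ (z : E) (u : ι → ℂ), (∀ i, ‖u i‖ ≤ 1) → ∀ s : Finset ι,
      ‖∑ i ∈ s, (u i * b.coord i z) • b i‖ ≤ K * ‖z‖ := by
  obtain ⟨C, hC⟩ := UnconditionalSchauderBasis.exists_norm_proj_le b
  have hC0 : 0 ≤ C := (norm_nonneg _).trans (hC ∅)
  have hunit : ∀ (z : E) (a : ι → ℝ), (∀ i, 0 ≤ a i ∧ a i ≤ 1) → ∀ s : Finset ι,
      ‖∑ i ∈ s, a i • (b.coord i z • b i)‖ ≤ C * ‖z‖ := by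
    intro z a ha s
    have := norm_add_sum_smul_le (fun i => b.coord i z • b i) a ha (C * ‖z‖) s 0 fun t _ => by
      rw [zero_add, ← GeneralSchauderBasis.proj_apply]
      exact (b.proj t).le_of_opNorm_le (hC t) z
    rwa [zero_add] at this
  have hreal : ∀ (z : E) (a : ι → ℝ), (∀ i, |a i| ≤ 1) → ∀ s : Finset ι,
      ‖∑ i ∈ s, a i • (b.coord i z • b i)‖ ≤ 3 * C * ‖z‖ := by
    intro z a ha s
    -- A multiplier in `[-1, 1]` is `2t - 1` with `t` in `[0, 1]`, whence the factor `3 = 2 + 1`.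
    have h1 := hunit z (fun i => (1 + a i) / 2) (fun i => by
      have := abs_le.1 (ha i); constructor <;> linarith) s
    have h2 := hunit z (fun _ => 1) (fun i => by norm_num) s
    have e : ∑ i ∈ s, a i • (b.coord i z • b i)
        = (2 : ℝ) • ∑ i ∈ s, ((1 + a i) / 2) • (b.coord i z • b i)
          - ∑ i ∈ s, (1 : ℝ) • (b.coord i z • b i) := by
      rw [Finset.smul_sum, ← Finset.sum_sub_distrib]
      exact Finset.sum_congr rfl fun i _ => by module
    rw [e]
    refine (norm_sub_le _ _).trans ?_
    rw [norm_smul, Real.norm_of_nonneg (by norm_num : (0 : ℝ) ≤ 2)]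
    linarith
  -- Real and imaginary parts cost `3 * C` each; the `+ 1` keeps the constant positive when `C = 0`.
  refine ⟨6 * C + 1, by positivity, fun z u hu s => ?_⟩
  have h1 := hreal z (fun i => (u i).re) (fun i => (Complex.abs_re_le_norm _).trans (hu i)) s
  have h2 := hreal z (fun i => (u i).im) (fun i => (Complex.abs_im_le_norm _).trans (hu i)) s
  have e : ∑ i ∈ s, (u i * b.coord i z) • b i
      = ∑ i ∈ s, (u i).re • (b.coord i z • b i)
        + Complex.I • ∑ i ∈ s, (u i).im • (b.coord i z • b i) := by
    rw [Finset.smul_sum, ← Finset.sum_add_distrib]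
    refine Finset.sum_congr rfl fun i _ => ?_
    rw [← Complex.coe_smul, ← Complex.coe_smul, smul_smul, smul_smul, smul_smul, ← add_smul]
    congr 1
    conv_lhs => rw [← Complex.re_add_im (u i)]
    ring
  rw [e]
  refine (norm_add_le _ _).trans ?_
  rw [norm_smul, Complex.norm_I, one_mul]
  nlinarith [norm_nonneg z]

/-- The modulus is bounded for the norm of `E`. -/
theorem exists_norm_modulus_le [CompleteSpace E] (b : UnconditionalSchauderBasis ι ℂ E) :
    ∃ K : ℝ, 0 < K ∧ ∀ z : E, ‖(modulus b z : E)‖ ≤ K * ‖z‖ := by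
  obtain ⟨K, hK, h⟩ := exists_norm_sum_multiplier_le b
  refine ⟨K, hK, fun z => ?_⟩
  refine le_of_tendsto (hasSum_modulus b z).norm (Filter.Eventually.of_forall fun s => ?_)
  -- The modulus is the effect of a unimodular multiplier. Where a coordinate vanishes, division by
  -- zero makes the multiplier `0`.
  have e : ∀ i, (‖b.coord i z‖ : ℂ)
      = (starRingEnd ℂ) (b.coord i z) / ‖b.coord i z‖ * b.coord i z := fun i => by
    by_cases h0 : b.coord i z = 0
    · simp [h0]
    · have h1 : (‖b.coord i z‖ : ℂ) ≠ 0 := by simpa using h0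
      rw [div_mul_eq_mul_div, eq_div_iff h1, Complex.conj_mul', sq]
  rw [Finset.sum_congr rfl fun i _ => congrArg (· • b i) (e i)]
  refine h z (fun i => (starRingEnd ℂ) (b.coord i z) / ‖b.coord i z‖) (fun i => ?_) s
  simp only [norm_div, RCLike.norm_conj, Complex.norm_real, norm_norm]
  exact div_self_le_one _

theorem isNonneg_modulus [CompleteSpace E] (b : UnconditionalSchauderBasis ι ℂ E) (z : E) :
    IsNonneg b (modulus b z) := fun i => by
  rw [coord_modulus, Complex.ofReal_re]; exact norm_nonneg _

/-- Coordinates of sums of moduli. -/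
theorem coord_sum_modulus [CompleteSpace E] (b : UnconditionalSchauderBasis ι ℂ E) {κ : Type*}
    (s : Finset κ) (x : κ → E) (i : ι) :
    b.coord i (∑ k ∈ s, (modulus b (x k) : E)) = ((∑ k ∈ s, ‖b.coord i (x k)‖ : ℝ) : ℂ) := by
  rw [map_sum, Complex.ofReal_sum]
  exact Finset.sum_congr rfl fun k _ => coord_modulus b _ _

/-! ### Multilinear forms given by absolutely convergent coefficient series -/

/-- The coefficients of an `m`-linear form with respect to the basis. -/
def coeff (b : UnconditionalSchauderBasis ι ℂ E) {m : ℕ}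
    (A : MultilinearMap ℂ (fun _ : Fin m => E) ℂ) (i : Fin m → ι) : ℂ :=
  A fun j => b (i j)

/-- The series with coefficients `a` converges absolutely on the diagonal of `E`. -/
def IsAbsSummable (b : UnconditionalSchauderBasis ι ℂ E) {m : ℕ} (a : (Fin m → ι) → ℂ) : Prop :=
  ∀ v : E, Summable fun i : Fin m → ι => ‖a i‖ * ∏ j, ‖b.coord (i j) v‖

/-- The diagonal controls all arguments, because every `|x_k|` lies below the single vector `∑
|x_k|`. -/
theorem IsAbsSummable.summable_norm [CompleteSpace E] {b : UnconditionalSchauderBasis ι ℂ E}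
    {m : ℕ} {a : (Fin m → ι) → ℂ} (ha : IsAbsSummable b a) (x : Fin m → E) :
    Summable fun i : Fin m → ι => ‖a i‖ * ∏ j, ‖b.coord (i j) (x j)‖ := by
  refine (ha (∑ k, (modulus b (x k) : E))).of_nonneg_of_le (fun i => by positivity) fun i => ?_
  refine mul_le_mul_of_nonneg_left (Finset.prod_le_prod (fun _ _ => norm_nonneg _)
    fun j _ => ?_) (norm_nonneg _)
  rw [coord_sum_modulus, Complex.norm_real, Real.norm_of_nonneg (by positivity)]
  exact Finset.single_le_sum (f := fun k => ‖b.coord (i j) (x k)‖) (fun _ _ => norm_nonneg _)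
    (Finset.mem_univ j)

theorem IsAbsSummable.summable [CompleteSpace E] {b : UnconditionalSchauderBasis ι ℂ E}
    {m : ℕ} {a : (Fin m → ι) → ℂ} (ha : IsAbsSummable b a) (x : Fin m → E) :
    Summable fun i : Fin m → ι => a i * ∏ j, b.coord (i j) (x j) := by
  refine Summable.of_norm ((ha.summable_norm x).congr fun i => ?_)
  rw [norm_mul, norm_prod]

/-- The form `x ↦ ∑ a_i ∏ⱼ (xⱼ)_{i_j}`. -/
noncomputable def seriesForm [CompleteSpace E] (b : UnconditionalSchauderBasis ι ℂ E)
    {m : ℕ} (a : (Fin m → ι) → ℂ) (ha : IsAbsSummable b a) :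
    MultilinearMap ℂ (fun _ : Fin m => E) ℂ where
  toFun x := ∑' i : Fin m → ι, a i * ∏ j, b.coord (i j) (x j)
  map_update_add' x k u v := by
    rw [← (ha.summable _).tsum_add (ha.summable _)]
    refine tsum_congr fun i => ?_
    rw [← mul_add]
    congr 1
    exact ((MultilinearMap.mkPiAlgebra ℂ (Fin m) ℂ).compLinearMap
      fun j => (b.coord (i j)).toLinearMap).map_update_add x k u v
  map_update_smul' x k c v := by
    rw [smul_eq_mul, ← tsum_mul_left]
    refine tsum_congr fun i => ?_
    rw [mul_left_comm]
    congr 1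
    exact ((MultilinearMap.mkPiAlgebra ℂ (Fin m) ℂ).compLinearMap
      fun j => (b.coord (i j)).toLinearMap).map_update_smul x k c v

theorem seriesForm_apply [CompleteSpace E] (b : UnconditionalSchauderBasis ι ℂ E)
    {m : ℕ} (a : (Fin m → ι) → ℂ) (ha : IsAbsSummable b a) (x : Fin m → E) :
    seriesForm b a ha x = ∑' i : Fin m → ι, a i * ∏ j, b.coord (i j) (x j) := rfl

theorem hasSum_seriesForm [CompleteSpace E] (b : UnconditionalSchauderBasis ι ℂ E)
    {m : ℕ} (a : (Fin m → ι) → ℂ) (ha : IsAbsSummable b a) (x : Fin m → E) :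
    HasSum (fun i : Fin m → ι => a i * ∏ j, b.coord (i j) (x j)) (seriesForm b a ha x) :=
  (ha.summable x).hasSum

/-- Reindexing of the arguments in a coefficient series. -/
theorem prod_coord_comp_perm (b : UnconditionalSchauderBasis ι ℂ E) {m : ℕ}
    (σ : Equiv.Perm (Fin m)) (i : Fin m → ι) (x : Fin m → E) :
    ∏ j, b.coord (i (σ j)) (x (σ j)) = ∏ j, b.coord (i j) (x j) :=
  Equiv.prod_comp σ fun j => b.coord (i j) (x j)

theorem seriesForm_comp_perm [CompleteSpace E] (b : UnconditionalSchauderBasis ι ℂ E)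
    {m : ℕ} (a : (Fin m → ι) → ℂ) (ha : IsAbsSummable b a)
    (hs : ∀ (σ : Equiv.Perm (Fin m)) i, a (i ∘ σ) = a i) (σ : Equiv.Perm (Fin m))
    (x : Fin m → E) : seriesForm b a ha (fun j => x (σ j)) = seriesForm b a ha x := by
  rw [seriesForm_apply, seriesForm_apply,
    ← (Equiv.arrowCongr σ.symm (Equiv.refl ι)).tsum_eq]
  refine tsum_congr fun i => ?_
  rw [← prod_coord_comp_perm b σ i x, ← hs σ i]
  rfl

theorem coeff_seriesForm [CompleteSpace E] (b : UnconditionalSchauderBasis ι ℂ E)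
    {m : ℕ} (a : (Fin m → ι) → ℂ) (ha : IsAbsSummable b a) : coeff b (seriesForm b a ha) = a := by
  classical
  funext i
  rw [coeff, seriesForm_apply, tsum_eq_single i]
  · simp [b.ortho]
  · intro k hk
    obtain ⟨j, hj⟩ := Function.ne_iff.1 hk
    rw [Finset.prod_eq_zero (Finset.mem_univ j), mul_zero]
    simp [b.ortho, hj]

/-- Along the finite subsets `F` of the index set, the sums over words in `F` exhaust a series
over all words. -/
theorem tendsto_piFinset_atTop (m : ℕ) :
    Filter.Tendsto (fun F : Finset ι => Fintype.piFinset fun _ : Fin m => F)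
      Filter.atTop Filter.atTop := by
  classical
  refine Filter.tendsto_atTop_finset_of_monotone
    (fun F G h => Fintype.piFinset_subset _ _ fun _ => h) fun i => ?_
  exact ⟨Finset.univ.image i, Fintype.mem_piFinset.2 fun j =>
    Finset.mem_image_of_mem _ (Finset.mem_univ j)⟩

theorem map_proj_eq_sum (b : UnconditionalSchauderBasis ι ℂ E) {m : ℕ}
    (A : MultilinearMap ℂ (fun _ : Fin m => E) ℂ) (F : Finset ι) (x : Fin m → E) :
    A (fun j => b.proj F (x j)) = ∑ i ∈ Fintype.piFinset fun _ : Fin m => F,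
      coeff b A i * ∏ j, b.coord (i j) (x j) := by
  classical
  simp only [GeneralSchauderBasis.proj_apply]
  rw [A.map_sum_finset]
  refine Finset.sum_congr rfl fun i _ => ?_
  rw [A.map_smul_univ, smul_eq_mul, mul_comm, coeff]

/-- A continuous form with absolutely summable coefficients is the sum of its coefficient
series. -/
theorem hasSum_coeff [CompleteSpace E] (b : UnconditionalSchauderBasis ι ℂ E) {m : ℕ}
    {A : MultilinearMap ℂ (fun _ : Fin m => E) ℂ} (hA : Continuous A)
    (ha : IsAbsSummable b (coeff b A)) (x : Fin m → E) :
    HasSum (fun i : Fin m → ι => coeff b A i * ∏ j, b.coord (i j) (x j)) (A x) := by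
  -- The partial sums over words in `F` are the values of `A` at truncated arguments. Their limit is
  -- the sum of the series, and also `A x` by continuity.
  have h1 := (ha.summable x).hasSum.comp (tendsto_piFinset_atTop m)
  have h2 : Filter.Tendsto (fun F : Finset ι => A fun j => b.proj F (x j)) Filter.atTop
      (𝓝 (A x)) := by
    refine (hA.tendsto x).comp (tendsto_pi_nhds.2 fun j => ?_)
    exact b.tendsto_proj (x j)
  simp only [map_proj_eq_sum] at h2
  rw [← tendsto_nhds_unique h1 h2]
  exact (ha.summable x).hasSum

/-! ### Positive forms -/

/-- The basis vectors, as elements of the real part. -/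
def basisVec (b : UnconditionalSchauderBasis ι ℂ E) (i : ι) : realPart b :=
  ⟨b i, fun j => by
    classical
    rw [b.ortho, Pi.single_apply]
    split_ifs <;> simp⟩

theorem isNonneg_basisVec (b : UnconditionalSchauderBasis ι ℂ E) (i : ι) :
    IsNonneg b (basisVec b i) := fun j => by
  classical
  show 0 ≤ (b.coord j (b i)).re
  rw [b.ortho, Pi.single_apply]
  split_ifs <;> simp

theorem IsNonneg.add {b : UnconditionalSchauderBasis ι ℂ E} {x y : realPart b}
    (hx : IsNonneg b x) (hy : IsNonneg b y) : IsNonneg b (x + y) := fun i => by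
  rw [Submodule.coe_add, map_add, Complex.add_re]
  exact add_nonneg (hx i) (hy i)

/-- The coordinates of real vectors are real. -/
theorem coord_eq_re (b : UnconditionalSchauderBasis ι ℂ E) (x : realPart b) (i : ι) :
    b.coord i (x : E) = ((b.coord i (x : E)).re : ℂ) :=
  Complex.ext rfl (by rw [x.2 i, Complex.ofReal_im])

theorem IsPositive.add {b : UnconditionalSchauderBasis ι ℂ E} {m : ℕ} {A B : RealForm b m}
    (hA : IsPositive A) (hB : IsPositive B) : IsPositive (A + B) :=
  ⟨fun σ x => by
    rw [_root_.add_apply, _root_.add_apply, hA.1 σ x, hB.1 σ x],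
    fun x hx => add_nonneg (hA.2 x hx) (hB.2 x hx)⟩

/-- Positive forms are monotone on positive vectors. -/
theorem IsPositive.le_map_add {b : UnconditionalSchauderBasis ι ℂ E} {m : ℕ} {A : RealForm b m}
    (hA : IsPositive A) (x y : Fin m → realPart b) (hx : ∀ j, IsNonneg b (x j))
    (hy : ∀ j, IsNonneg b (y j)) : A x ≤ A (x + y) := by
  classical
  rw [A.map_add_univ]
  -- `A x` is one of the `2 ^ m` terms in the expansion of `A (x + y)`; the others are nonnegative.
  have h : A x = A (Finset.univ.piecewise x y) := by rw [Finset.piecewise_univ]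
  rw [h]
  refine Finset.single_le_sum (f := fun s : Finset (Fin m) => A (s.piecewise x y))
    (fun s _ => hA.2 _ fun j => ?_) (Finset.mem_univ _)
  by_cases hj : j ∈ s
  · rw [Finset.piecewise_eq_of_mem _ _ _ hj]; exact hx j
  · rw [Finset.piecewise_eq_of_notMem _ _ _ hj]; exact hy j

/-- The finite sums of the basis expansion of a positive form are bounded by the form. -/
theorem IsPositive.sum_le {b : UnconditionalSchauderBasis ι ℂ E} {m : ℕ} {A : RealForm b m}
    (hA : IsPositive A) (F : Finset ι) (x : Fin m → realPart b) (hx : ∀ j, IsNonneg b (x j)) :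
    ∑ i ∈ Fintype.piFinset (fun _ : Fin m => F),
      (A fun j => basisVec b (i j)) * ∏ j, (b.coord (i j) (x j : E)).re ≤ A x := by
  classical
  -- `p` truncates `x` to the coordinates in `F`. Both `p` and `x - p` are positive, so monotonicity
  -- gives `A p ≤ A x`.
  let p : Fin m → realPart b :=
    fun j => ∑ k ∈ F, (b.coord k (x j : E)).re • basisVec b k
  have hp : A p = ∑ i ∈ Fintype.piFinset (fun _ : Fin m => F),
      (A fun j => basisVec b (i j)) * ∏ j, (b.coord (i j) (x j : E)).re := by
    rw [A.map_sum_finset]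
    refine Finset.sum_congr rfl fun i _ => ?_
    rw [A.map_smul_univ, smul_eq_mul, mul_comm]
  have hpc : ∀ j k, (b.coord k (p j : E)).re = if k ∈ F then (b.coord k (x j : E)).re else 0 := by
    intro j k
    have : (p j : E) = b.proj F (x j) := by
      rw [GeneralSchauderBasis.proj_apply, Submodule.coe_sum]
      refine Finset.sum_congr rfl fun i _ => ?_
      rw [coord_eq_re b (x j) i]
      rfl
    rw [this, GeneralSchauderBasis.proj_apply, map_sum]
    simp only [map_smul, b.ortho, Pi.single_apply, smul_eq_mul, mul_ite, mul_one, mul_zero]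
    rw [Finset.sum_ite_eq F k]
    split_ifs <;> simp
  rw [← hp]
  have := hA.le_map_add p (x - p) (fun j k => ?_) fun j k => ?_
  · rwa [add_sub_cancel] at this
  · rw [hpc]
    split_ifs
    · exact hx j k
    · exact le_rfl
  · rw [Pi.sub_apply, Submodule.coe_sub, map_sub, Complex.sub_re, hpc]
    split_ifs
    · rw [sub_self]
    · rw [sub_zero]; exact hx j k

theorem reForm_apply (b : UnconditionalSchauderBasis ι ℂ E) {m : ℕ}
    (A : MultilinearMap ℂ (fun _ : Fin m => E) ℂ) (x : Fin m → realPart b) :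
    reForm b A x = (A fun j => (x j : E)).re := rfl

theorem imForm_apply (b : UnconditionalSchauderBasis ι ℂ E) {m : ℕ}
    (A : MultilinearMap ℂ (fun _ : Fin m => E) ℂ) (x : Fin m → realPart b) :
    imForm b A x = (A fun j => (x j : E)).im := rfl

theorem prod_coord_real (b : UnconditionalSchauderBasis ι ℂ E) {m : ℕ} (i : Fin m → ι)
    (x : Fin m → realPart b) : ∏ j, b.coord (i j) (x j : E)
      = ((∏ j, (b.coord (i j) (x j : E)).re : ℝ) : ℂ) := by
  rw [Complex.ofReal_prod]
  exact Finset.prod_congr rfl fun j _ => coord_eq_re b (x j) (i j)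

/-- The coefficients of a regular form are absolutely summable. -/
theorem IsRegular.isAbsSummable [CompleteSpace E] {b : UnconditionalSchauderBasis ι ℂ E} {m : ℕ}
    {A : MultilinearMap ℂ (fun _ : Fin m => E) ℂ} (hA : IsRegular b A) :
    IsAbsSummable b (coeff b A) := by
  classical
  obtain ⟨⟨B, C, hB, hC, h0⟩, ⟨B', C', hB', hC', h1⟩⟩ := hA
  have hD := ((hB.add hC).add hB').add hC'
  -- On basis vectors `D` dominates `|Re A| + |Im A|`, hence the norm of each coefficient.
  set D := B + C + B' + C' with hDdef
  intro v
  refine summable_of_sum_le (c := D fun _ => modulus b v) (fun i => by positivity) fun T => ?_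
  obtain ⟨F, hF⟩ := Filter.eventually_atTop.1
    ((tendsto_piFinset_atTop (ι := ι) m).eventually_ge_atTop T)
  refine le_trans ?_ (hD.sum_le F (fun _ => modulus b v) fun _ => isNonneg_modulus b v)
  refine (Finset.sum_le_sum_of_subset_of_nonneg (hF F le_rfl) fun i _ _ => by positivity).trans ?_
  refine Finset.sum_le_sum fun i _ => ?_
  simp only [coord_modulus, Complex.ofReal_re]
  refine mul_le_mul_of_nonneg_right ?_ (by positivity)
  have e : ∀ j, IsNonneg b (basisVec b (i j)) := fun j => isNonneg_basisVec b _
  have hB := hB.2 _ e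
  have hC := hC.2 _ e
  have hB' := hB'.2 _ e
  have hC' := hC'.2 _ e
  have hre : (coeff b A i).re = B (fun j => basisVec b (i j)) - C (fun j => basisVec b (i j)) :=
    DFunLike.congr_fun h0 fun j => basisVec b (i j)
  have him : (coeff b A i).im = B' (fun j => basisVec b (i j)) - C' (fun j => basisVec b (i j)) :=
    DFunLike.congr_fun h1 fun j => basisVec b (i j)
  refine (Complex.norm_le_abs_re_add_abs_im _).trans ?_
  rw [hre, him, hDdef]
  simp only [_root_.add_apply]
  have h2 := abs_le.2 (⟨by linarith, by linarith⟩ : -(B (fun j => basisVec b (i j)) +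
    C (fun j => basisVec b (i j))) ≤ B (fun j => basisVec b (i j)) - C (fun j => basisVec b (i j))
    ∧ B (fun j => basisVec b (i j)) - C (fun j => basisVec b (i j)) ≤
    B (fun j => basisVec b (i j)) + C (fun j => basisVec b (i j)))
  have h3 := abs_le.2 (⟨by linarith, by linarith⟩ : -(B' (fun j => basisVec b (i j)) +
    C' (fun j => basisVec b (i j))) ≤ B' (fun j => basisVec b (i j)) - C' (fun j => basisVec b (i j))
    ∧ B' (fun j => basisVec b (i j)) - C' (fun j => basisVec b (i j)) ≤
    B' (fun j => basisVec b (i j)) + C' (fun j => basisVec b (i j)))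
  linarith

/-! ### The modulus of a regular form -/

theorem IsAbsSummable.norm {b : UnconditionalSchauderBasis ι ℂ E} {m : ℕ}
    {a : (Fin m → ι) → ℂ} (ha : IsAbsSummable b a) : IsAbsSummable b fun i => (‖a i‖ : ℂ) :=
  fun v => (ha v).congr fun i => by rw [Complex.norm_real, norm_norm]

/-- The real form with coefficients `‖a i‖`. -/
noncomputable def absForm [CompleteSpace E] (b : UnconditionalSchauderBasis ι ℂ E) {m : ℕ}
    (a : (Fin m → ι) → ℂ) (ha : IsAbsSummable b a) : RealForm b m :=
  reForm b (seriesForm b (fun i => (‖a i‖ : ℂ)) ha.norm)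

theorem hasSum_absForm [CompleteSpace E] (b : UnconditionalSchauderBasis ι ℂ E) {m : ℕ}
    (a : (Fin m → ι) → ℂ) (ha : IsAbsSummable b a) (x : Fin m → realPart b) :
    HasSum (fun i => ‖a i‖ * ∏ j, (b.coord (i j) (x j : E)).re) (absForm b a ha x) := by
  have := Complex.hasSum_re (hasSum_seriesForm b _ ha.norm fun j => (x j : E))
  simp only [prod_coord_real, ← Complex.ofReal_mul, Complex.ofReal_re] at this
  exact this

theorem absForm_modulus [CompleteSpace E] (b : UnconditionalSchauderBasis ι ℂ E) {m : ℕ}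
    (a : (Fin m → ι) → ℂ) (ha : IsAbsSummable b a) (v : E) :
    absForm b a ha (fun _ => modulus b v)
      = ∑' i : Fin m → ι, ‖a i‖ * ∏ j, ‖b.coord (i j) v‖ := by
  rw [← (hasSum_absForm b a ha _).tsum_eq]
  simp only [coord_modulus, Complex.ofReal_re]

theorem isSymmetric_absForm [CompleteSpace E] (b : UnconditionalSchauderBasis ι ℂ E) {m : ℕ}
    (a : (Fin m → ι) → ℂ) (ha : IsAbsSummable b a)
    (hs : ∀ (σ : Equiv.Perm (Fin m)) i, a (i ∘ σ) = a i) : IsSymmetric (absForm b a ha) := by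
  intro σ x
  rw [absForm, reForm_apply, reForm_apply]
  exact congrArg Complex.re (seriesForm_comp_perm b _ ha.norm
    (fun σ i => by rw [hs σ i]) σ fun j => (x j : E))

/-- A symmetric form is positive if it is given by a series with nonnegative coefficients. -/
theorem isPositive_of_hasSum {b : UnconditionalSchauderBasis ι ℂ E} {m : ℕ} {A : RealForm b m}
    (hs : IsSymmetric A) {a : (Fin m → ι) → ℝ} (ha : ∀ i, 0 ≤ a i)
    (h : ∀ x, HasSum (fun i => a i * ∏ j, (b.coord (i j) (x j : E)).re) (A x)) :
    IsPositive A :=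
  ⟨hs, fun x hx => (h x).nonneg fun i =>
    mul_nonneg (ha i) (Finset.prod_nonneg fun j _ => hx j (i j))⟩

theorem isPositive_absForm [CompleteSpace E] (b : UnconditionalSchauderBasis ι ℂ E) {m : ℕ}
    (a : (Fin m → ι) → ℂ) (ha : IsAbsSummable b a)
    (hs : ∀ (σ : Equiv.Perm (Fin m)) i, a (i ∘ σ) = a i) : IsPositive (absForm b a ha) :=
  isPositive_of_hasSum (isSymmetric_absForm b a ha hs) (fun i => norm_nonneg (a i))
    (hasSum_absForm b a ha)

/-- The left side is the real part of `e^{-iθ} z`. -/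
theorem cos_mul_re_add_sin_mul_im_le (θ : ℝ) (z : ℂ) :
    Real.cos θ * z.re + Real.sin θ * z.im ≤ ‖z‖ := by
  refine Real.le_sqrt_of_sq_le ?_ |>.trans_eq (Complex.norm_eq_sqrt_sq_add_sq z).symm
  nlinarith [Real.sin_sq_add_cos_sq θ, sq_nonneg (Real.cos θ * z.im - Real.sin θ * z.re)]

theorem exists_cos_mul_re_add_sin_mul_im (z : ℂ) :
    ∃ θ : ℝ, Real.cos θ * z.re + Real.sin θ * z.im = ‖z‖ := by
  refine ⟨z.arg, ?_⟩
  conv_lhs => rw [← Complex.norm_mul_cos_arg z, ← Complex.norm_mul_sin_arg z]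
  linear_combination ‖z‖ * Real.sin_sq_add_cos_sq z.arg

section modulus

variable [CompleteSpace E] {b : UnconditionalSchauderBasis ι ℂ E} {m : ℕ}
  {A : MultilinearMap ℂ (fun _ : Fin m => E) ℂ}

theorem isPositive_absForm_sub (hs : ∀ (σ : Equiv.Perm (Fin m)) x, A (x ∘ σ) = A x)
    (hc : Continuous A) (ha : IsAbsSummable b (coeff b A)) (θ : ℝ) :
    IsPositive (absForm b (coeff b A) ha
      - (Real.cos θ • reForm b A + Real.sin θ • imForm b A)) := by
  refine isPositive_of_hasSum (a := fun i => ‖coeff b A i‖ -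
    (Real.cos θ * (coeff b A i).re + Real.sin θ * (coeff b A i).im)) ?_
    (fun i => sub_nonneg.2 (cos_mul_re_add_sin_mul_im_le θ _)) fun x => ?_
  · intro σ x
    have h1 := isSymmetric_absForm b (coeff b A) ha (fun σ i => hs σ fun j => b (i j)) σ x
    have h2 := hs σ fun j => (x j : E)
    simp only [_root_.sub_apply, _root_.add_apply, _root_.smul_apply,
      reForm_apply, imForm_apply, h1]
    rw [← h2]
    rfl
  · have h := hasSum_coeff b hc ha fun j => (x j : E)
    have h0 := (Complex.hasSum_re h).mul_left (Real.cos θ)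
    have h1 := (Complex.hasSum_im h).mul_left (Real.sin θ)
    have h2 := (hasSum_absForm b (coeff b A) ha x).sub (h0.add h1)
    simp only [prod_coord_real, Complex.re_mul_ofReal, Complex.im_mul_ofReal, ← mul_assoc,
      ← add_mul, ← sub_mul] at h2
    exact h2

/-- With `Q` the form of absolute coefficients, the angles `0` and `π / 2` write the real and
imaginary parts as `Q - (Q - A₀)` and `Q - (Q - A₁)`. -/
theorem isRegular_of_isAbsSummable (hs : ∀ (σ : Equiv.Perm (Fin m)) x, A (x ∘ σ) = A x)
    (hc : Continuous A) (ha : IsAbsSummable b (coeff b A)) : IsRegular b A := by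
  have h := isPositive_absForm b (coeff b A) ha fun σ i => hs σ fun j => b (i j)
  refine ⟨⟨_, _, h, isPositive_absForm_sub hs hc ha 0, ?_⟩,
    ⟨_, _, h, isPositive_absForm_sub hs hc ha (Real.pi / 2), ?_⟩⟩
  · simp
  · simp

/-- The modulus of a form has as coefficients the absolute values of the coefficients. -/
theorem isModulus_absForm (hs : ∀ (σ : Equiv.Perm (Fin m)) x, A (x ∘ σ) = A x)
    (hc : Continuous A) (ha : IsAbsSummable b (coeff b A)) :
    IsModulus b A (absForm b (coeff b A) ha) where
  regular := ⟨_, 0, isPositive_absForm b _ ha fun σ i => hs σ fun j => b (i j),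
    ⟨fun _ _ => rfl, fun _ _ => le_rfl⟩, (sub_zero _).symm⟩
  upper := isPositive_absForm_sub hs hc ha
  least R _ hR := by
    have hRs : IsSymmetric R := fun σ x => by
      have h1 := (hR 0).1 σ x
      have h2 := congrArg Complex.re (hs σ fun j => (x j : E))
      simp only [Real.cos_zero, Real.sin_zero, one_smul, zero_smul, add_zero,
        _root_.sub_apply, reForm_apply] at h1
      have h3 : (A ((fun j => (x j : E)) ∘ σ)).re = (A fun j => (x (σ j) : E)).re := rfl
      linarith
    have hRle : ∀ θ (x : Fin m → realPart b), (∀ j, IsNonneg b (x j)) →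
        Real.cos θ * (A fun j => (x j : E)).re + Real.sin θ * (A fun j => (x j : E)).im
          ≤ R x := fun θ x hx => sub_nonneg.1 ((hR θ).2 x hx)
    -- The angles `0` and `π` put both `Re A` and `-Re A` below `R`.
    have hRpos : IsPositive R := by
      refine ⟨hRs, fun x hx => ?_⟩
      have h1 := hRle 0 x hx
      have h2 := hRle Real.pi x hx
      simp only [Real.cos_zero, Real.sin_zero, Real.cos_pi, Real.sin_pi] at h1 h2
      linarith
    -- The angle may depend on the word: the argument of the coefficient attains its absolute value.
    have hRc : ∀ i : Fin m → ι, ‖coeff b A i‖ ≤ R fun j => basisVec b (i j) := by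
      intro i
      obtain ⟨θ, hθ⟩ := exists_cos_mul_re_add_sin_mul_im (coeff b A i)
      rw [← hθ]
      exact hRle θ (fun j => basisVec b (i j)) fun j => isNonneg_basisVec b _
    refine ⟨fun σ x => ?_, fun x hx => sub_nonneg.2 ?_⟩
    · rw [_root_.sub_apply, _root_.sub_apply, hRs σ x,
        isSymmetric_absForm b (coeff b A) ha (fun σ i => hs σ fun j => b (i j)) σ x]
    · refine le_of_tendsto ((hasSum_absForm b _ ha x).comp (tendsto_piFinset_atTop m))
        (Filter.Eventually.of_forall fun F => ?_)
      refine le_trans (Finset.sum_le_sum fun i _ => ?_) (hRpos.sum_le F x hx)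
      exact mul_le_mul_of_nonneg_right (hRc i) (Finset.prod_nonneg fun j _ => hx j (i j))

end modulus

/-- Moduli are unique on positive vectors. -/
theorem IsModulus.eq_of_nonneg {b : UnconditionalSchauderBasis ι ℂ E} {m : ℕ}
    {A : MultilinearMap ℂ (fun _ : Fin m => E) ℂ} {P Q : RealForm b m} (hP : IsModulus b A P)
    (hQ : IsModulus b A Q) (x : Fin m → realPart b) (hx : ∀ j, IsNonneg b (x j)) : P x = Q x :=
  le_antisymm (sub_nonneg.1 ((hP.least Q hQ.regular hQ.upper).2 x hx))
    (sub_nonneg.1 ((hQ.least P hP.regular hP.upper).2 x hx))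

theorem summable_sigma_words_iff {b : UnconditionalSchauderBasis ι ℂ E}
    {a : ∀ m : ℕ, (Fin m → ι) → ℂ} (ha : ∀ m, IsAbsSummable b (a m)) (v : E) :
    Summable (fun i : Σ m, Fin m → ι => ‖a i.1 i.2‖ * ∏ j, ‖b.coord (i.2 j) v‖) ↔
      Summable fun m => ∑' i : Fin m → ι, ‖a m i‖ * ∏ j, ‖b.coord (i j) v‖ := by
  rw [summable_sigma_of_nonneg fun i => by positivity]
  exact and_iff_right fun m => ha m v

/-- Regular convergence is absolute convergence of the series of all coefficients. -/
theorem regularlyConvergentAt_iff [CompleteSpace E] {b : UnconditionalSchauderBasis ι ℂ E}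
    {A : ∀ m : ℕ, MultilinearMap ℂ (fun _ : Fin m => E) ℂ}
    (hs : ∀ m (σ : Equiv.Perm (Fin m)) x, A m (x ∘ σ) = A m x) (hc : ∀ m, Continuous (A m))
    (ha : ∀ m, IsAbsSummable b (coeff b (A m))) (v : E) :
    RegularlyConvergentAt b A v ↔ Summable fun i : Σ m, Fin m → ι =>
      ‖coeff b (A i.1) i.2‖ * ∏ j, ‖b.coord (i.2 j) v‖ := by
  rw [summable_sigma_words_iff (a := fun m => coeff b (A m)) ha v]
  simp only [← absForm_modulus b _ (ha _)]
  constructor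
  · rintro ⟨Q, hQ, hsum⟩
    refine hsum.congr fun m => ?_
    exact (hQ m).eq_of_nonneg (isModulus_absForm (hs m) (hc m) (ha m)) _
      fun _ => isNonneg_modulus b v
  · exact fun h => ⟨_, fun m => isModulus_absForm (hs m) (hc m) (ha m), h⟩

/-! ### Local bounds for absolutely convergent expansions -/

theorem prod_norm_coord_le_of_norm_coord_le (b : UnconditionalSchauderBasis ι ℂ E) {m : ℕ}
    (i : Fin m → ι) {v w : E} (h : ∀ k, ‖b.coord k v‖ ≤ ‖b.coord k w‖) :
    ∏ j, ‖b.coord (i j) v‖ ≤ ∏ j, ‖b.coord (i j) w‖ :=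
  Finset.prod_le_prod (fun _ _ => norm_nonneg _) fun j _ => h (i j)

theorem prod_norm_coord_smul (b : UnconditionalSchauderBasis ι ℂ E) {m : ℕ}
    (i : Fin m → ι) (t : ℂ) (v : E) :
    ∏ j, ‖b.coord (i j) (t • v)‖ = ‖t‖ ^ m * ∏ j, ‖b.coord (i j) v‖ := by
  simp only [map_smul, smul_eq_mul, norm_mul, Finset.prod_mul_distrib, Finset.prod_const,
    Finset.card_univ, Fintype.card_fin]

/-- A sequence of sufficiently small vectors is dominated by a single small vector. -/
theorem exists_norm_coord_le_of_norm_le [CompleteSpace E] (b : UnconditionalSchauderBasis ι ℂ E)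
    {r : ℝ} (hr : 0 < r) : ∃ ε : ℕ → ℝ, (∀ n, 0 < ε n) ∧
      ∀ v : ℕ → E, (∀ n, ‖v n‖ ≤ ε n) →
        ∃ w : E, ‖w‖ < r ∧ ∀ n k, ‖b.coord k (v n)‖ ≤ ‖b.coord k w‖ := by
  obtain ⟨K, hK, hmod⟩ := exists_norm_modulus_le b
  -- The witness `w` is `∑ |v n|`; these radii give it norm at most `r / 2`.
  refine ⟨fun n => r / (4 * K) * (1 / 2) ^ n, fun n => by positivity, fun v hv => ?_⟩
  have hle : ∀ n, ‖(modulus b (v n) : E)‖ ≤ r / 4 * (1 / 2) ^ n := fun n => by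
    refine (hmod _).trans ((mul_le_mul_of_nonneg_left (hv n) hK.le).trans_eq ?_)
    field_simp
  have hg : HasSum (fun n : ℕ => r / 4 * (1 / 2) ^ n) (r / 4 * 2) :=
    hasSum_geometric_two.mul_left _
  have hs : Summable fun n => (modulus b (v n) : E) := Summable.of_norm_bounded hg.summable hle
  refine ⟨∑' n, (modulus b (v n) : E), ?_, fun n k => ?_⟩
  · have := tsum_of_norm_bounded hg hle
    linarith
  · have h1 : Summable fun n => ‖b.coord k (v n)‖ := by
      have := (hs.map (b.coord k) (b.coord k).continuous)
      refine (Complex.summable_ofReal).1 (this.congr fun n => ?_)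
      exact coord_modulus b (v n) k
    rw [(b.coord k).map_tsum hs]
    simp only [coord_modulus]
    rw [← Complex.ofReal_tsum, Complex.norm_real,
      Real.norm_of_nonneg (tsum_nonneg fun _ => norm_nonneg _)]
    exact h1.le_tsum n fun _ _ => norm_nonneg _

section words

variable {b : UnconditionalSchauderBasis ι ℂ E} {a : ∀ m : ℕ, (Fin m → ι) → ℂ}

/-- An expansion which converges absolutely near the origin is bounded near the origin. -/
theorem exists_tsum_words_le [CompleteSpace E]
    (h : ∀ᶠ v in 𝓝 (0 : E), Summable fun i : Σ m, Fin m → ι =>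
      ‖a i.1 i.2‖ * ∏ j, ‖b.coord (i.2 j) v‖) :
    ∃ ρ > 0, ∃ C : ℝ, 0 ≤ C ∧ ∀ v : E, ‖v‖ < ρ →
      (Summable fun i : Σ m, Fin m → ι => ‖a i.1 i.2‖ * ∏ j, ‖b.coord (i.2 j) v‖) ∧
      ∑' i : Σ m, Fin m → ι, ‖a i.1 i.2‖ * ∏ j, ‖b.coord (i.2 j) v‖ ≤ C := by
  obtain ⟨r, hr, hball⟩ := Metric.eventually_nhds_iff.1 h
  obtain ⟨ε, hε, hdom⟩ := exists_norm_coord_le_of_norm_le b hr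
  -- Otherwise some `v n` of norm below `ε n` has no sum bounded by `n`. One `w` in the ball of
  -- convergence dominates all `v n`, so its finite sum bounds all of theirs.
  by_contra! hcon
  choose v hv hv' using fun n : ℕ => hcon (ε n) (hε n) n n.cast_nonneg
  obtain ⟨w, hw, hle⟩ := hdom v fun n => (hv n).le
  have hsw := hball (y := w) (by rwa [dist_zero_right])
  have hterm : ∀ n (i : Σ m, Fin m → ι), ‖a i.1 i.2‖ * ∏ j, ‖b.coord (i.2 j) (v n)‖
      ≤ ‖a i.1 i.2‖ * ∏ j, ‖b.coord (i.2 j) w‖ := fun n i =>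
    mul_le_mul_of_nonneg_left (prod_norm_coord_le_of_norm_coord_le b _ (hle n)) (norm_nonneg _)
  have hsv : ∀ n, Summable fun i : Σ m, Fin m → ι =>
      ‖a i.1 i.2‖ * ∏ j, ‖b.coord (i.2 j) (v n)‖ :=
    fun n => hsw.of_nonneg_of_le (fun i => by positivity) (hterm n)
  obtain ⟨n, hn⟩ := exists_nat_ge (∑' i : Σ m, Fin m → ι, ‖a i.1 i.2‖ * ∏ j, ‖b.coord (i.2 j) w‖)
  exact absurd ((hsv n).tsum_le_tsum (hterm n) hsw) (not_le.2 (hn.trans_lt (hv' n (hsv n))))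

/-- If the whole expansion converges absolutely near the origin, then each homogeneous part
converges absolutely everywhere. -/
theorem isAbsSummable_of_eventually
    (h : ∀ᶠ v in 𝓝 (0 : E), Summable fun i : Σ m, Fin m → ι =>
      ‖a i.1 i.2‖ * ∏ j, ‖b.coord (i.2 j) v‖) (m : ℕ) : IsAbsSummable b (a m) := by
  intro v
  have ht : Filter.Tendsto (fun t : ℂ => t • v) (𝓝[≠] 0) (𝓝 0) := by
    have : Filter.Tendsto (fun t : ℂ => t • v) (𝓝 0) (𝓝 ((0 : ℂ) • v)) :=
      (continuous_id.smul continuous_const).tendsto 0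
    rw [zero_smul] at this
    exact this.mono_left nhdsWithin_le_nhds
  -- A nonzero scaling brings `v` into the neighbourhood; by homogeneity it only changes the series
  -- by the factor `‖t‖ ^ m`.
  obtain ⟨t, hs, ht0⟩ := ((ht.eventually h).and self_mem_nhdsWithin).exists
  have h1 := hs.comp_injective (sigma_mk_injective (i := m))
  refine (summable_mul_left_iff (pow_ne_zero m (norm_ne_zero_iff.2 ht0))).1 (h1.congr fun i => ?_)
  simp only [Function.comp_apply, prod_norm_coord_smul]
  ring

/-- The polarization inequality for forms with nonnegative coefficients. -/
theorem factorial_mul_tsum_le [CompleteSpace E] {m : ℕ} {a : (Fin m → ι) → ℂ} (ha : IsAbsSummable b a)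
    (hs : ∀ (σ : Equiv.Perm (Fin m)) i, a (i ∘ σ) = a i) (x : Fin m → E) :
    (m.factorial : ℝ) * ∑' i : Fin m → ι, ‖a i‖ * ∏ j, ‖b.coord (i j) (x j)‖
      ≤ ∑' i : Fin m → ι, ‖a i‖ * ∏ j, ‖b.coord (i j) (∑ k, (modulus b (x k) : E))‖ := by
  classical
  have hperm : ∀ σ : Equiv.Perm (Fin m),
      ∑' i : Fin m → ι, ‖a i‖ * ∏ j, ‖b.coord (i j) (x (σ j))‖
        = ∑' i : Fin m → ι, ‖a i‖ * ∏ j, ‖b.coord (i j) (x j)‖ := by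
    intro σ
    rw [← (Equiv.arrowCongr σ.symm (Equiv.refl ι)).tsum_eq]
    refine tsum_congr fun i => ?_
    rw [← Equiv.prod_comp σ fun j => ‖b.coord (i j) (x j)‖, ← hs σ i]
    rfl
  have hsum : ∀ σ : Equiv.Perm (Fin m),
      Summable fun i : Fin m → ι => ‖a i‖ * ∏ j, ‖b.coord (i j) (x (σ j))‖ :=
    fun σ => ha.summable_norm fun j => x (σ j)
  have e : (m.factorial : ℝ) * ∑' i : Fin m → ι, ‖a i‖ * ∏ j, ‖b.coord (i j) (x j)‖
      = ∑' i : Fin m → ι, ∑ σ : Equiv.Perm (Fin m),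
        ‖a i‖ * ∏ j, ‖b.coord (i j) (x (σ j))‖ := by
    rw [Summable.tsum_finsetSum fun σ _ => hsum σ, Finset.sum_congr rfl fun σ _ => hperm σ,
      Finset.sum_const, Finset.card_univ, Fintype.card_perm, Fintype.card_fin, nsmul_eq_mul]
  rw [e]
  refine Summable.tsum_le_tsum (fun i => ?_) (summable_sum fun σ _ => hsum σ) (ha _)
  rw [← Finset.mul_sum]
  refine mul_le_mul_of_nonneg_left ?_ (norm_nonneg _)
  have e2 : ∀ j, ‖b.coord (i j) (∑ k, (modulus b (x k) : E))‖
      = ∑ k, ‖b.coord (i j) (x k)‖ := fun j => by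
    rw [coord_sum_modulus, Complex.norm_real, Real.norm_of_nonneg (by positivity)]
  simp only [e2]
  rw [Finset.prod_univ_sum, Fintype.piFinset_univ]
  -- The product of sums expands over all maps `Fin m → Fin m`. Permutations are some of these, and
  -- the remaining terms are nonnegative.
  have e3 : ∑ σ : Equiv.Perm (Fin m), ∏ j, ‖b.coord (i j) (x (σ j))‖
      = ∑ τ ∈ Finset.univ.image fun σ : Equiv.Perm (Fin m) => (σ : Fin m → Fin m),
        ∏ j, ‖b.coord (i j) (x (τ j))‖ :=
    (Finset.sum_image (f := fun τ : Fin m → Fin m => ∏ j, ‖b.coord (i j) (x (τ j))‖)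
      fun (σ : Equiv.Perm (Fin m)) _ τ _ h => DFunLike.coe_injective h).symm
  rw [e3]
  exact Finset.sum_le_sum_of_subset_of_nonneg (Finset.subset_univ _) fun τ _ _ => by positivity

theorem tsum_le_tsum_words {v : E} (h : Summable fun i : Σ m, Fin m → ι =>
    ‖a i.1 i.2‖ * ∏ j, ‖b.coord (i.2 j) v‖) (m : ℕ) :
    ∑' i : Fin m → ι, ‖a m i‖ * ∏ j, ‖b.coord (i j) v‖
      ≤ ∑' i : Σ m, Fin m → ι, ‖a i.1 i.2‖ * ∏ j, ‖b.coord (i.2 j) v‖ := by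
  have h0 : ∀ i : Σ m, Fin m → ι, 0 ≤ ‖a i.1 i.2‖ * ∏ j, ‖b.coord (i.2 j) v‖ :=
    fun i => by positivity
  exact tsum_comp_le_tsum_of_inj h h0 (sigma_mk_injective (i := m))

/-- The loss from rescaling is `(m + 1) ^ m / m!`, which is at most `e ^ (m + 1)` and so only
geometric. -/
theorem le_exp_mul_pow_of_pow_mul_factorial_mul_le {K ρ C M : ℝ} (hK : 0 < K) (hρ : 0 < ρ)
    (hC : 0 ≤ C) (m : ℕ) (h : (ρ / (K * (m + 1))) ^ m * (m.factorial * M) ≤ C) :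
    M ≤ C * Real.exp 1 * (K * Real.exp 1 / ρ) ^ m := by
  have h1 := Real.pow_div_factorial_le_exp (m + 1 : ℝ) (by positivity) m
  have h2 : M ≤ C * (K / ρ) ^ m * ((m + 1 : ℝ) ^ m / m.factorial) := by
    have e : C * (K / ρ) ^ m * ((m + 1 : ℝ) ^ m / m.factorial)
        = C / ((ρ / (K * (m + 1))) ^ m * m.factorial) := by
      rw [div_pow, div_pow, mul_pow]
      field_simp
    rw [e, le_div_iff₀ (by positivity)]
    linarith
  refine h2.trans ((mul_le_mul_of_nonneg_left h1 (by positivity)).trans_eq ?_)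
  rw [Real.exp_add, ← Real.exp_one_pow m, div_pow, div_pow, mul_pow]
  ring

/-- Geometric bounds for the homogeneous forms of an expansion which is bounded near the
origin. -/
theorem exists_norm_seriesForm_le [CompleteSpace E] (hs : ∀ m (σ : Equiv.Perm (Fin m)) i, a m (i ∘ σ) = a m i)
    (h : ∀ᶠ v in 𝓝 (0 : E), Summable fun i : Σ m, Fin m → ι =>
      ‖a i.1 i.2‖ * ∏ j, ‖b.coord (i.2 j) v‖) :
    ∃ C R : ℝ, 0 ≤ C ∧ 0 < R ∧ ∀ m x, ‖seriesForm b (a m) (isAbsSummable_of_eventually h m) x‖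
      ≤ C * R ^ m * ∏ j, ‖x j‖ := by
  obtain ⟨ρ, hρ, C, hC, hbound⟩ := exists_tsum_words_le h
  obtain ⟨K, hK, hmod⟩ := exists_norm_modulus_le b
  have hunit : ∀ m (x : Fin m → E), (∀ j, ‖x j‖ ≤ 1) →
      ‖seriesForm b (a m) (isAbsSummable_of_eventually h m) x‖
        ≤ C * Real.exp 1 * (K * Real.exp 1 / ρ) ^ m := by
    intro m x hx
    have ha := isAbsSummable_of_eventually h m
    set M := ∑' i : Fin m → ι, ‖a m i‖ * ∏ j, ‖b.coord (i j) (x j)‖ with hM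
    have h1 : ‖seriesForm b (a m) ha x‖ ≤ M := by
      rw [seriesForm_apply]
      refine (norm_tsum_le_tsum_norm (ha.summable x).norm).trans_eq (tsum_congr fun i => ?_)
      rw [norm_mul, norm_prod]
    set s : E := ∑ k, (modulus b (x k) : E)
    have hsn : ‖s‖ ≤ m * K := by
      refine (norm_sum_le _ _).trans ?_
      refine (Finset.sum_le_card_nsmul _ _ K fun k _ => (hmod _).trans ?_).trans_eq ?_
      · nlinarith [hx k]
      · rw [Finset.card_univ, Fintype.card_fin, nsmul_eq_mul]
    -- As `‖s‖ ≤ m * K`, this factor brings `s` strictly inside the ball of radius `ρ`; `m + 1` also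
    -- avoids dividing by zero at `m = 0`.
    set t : ℝ := ρ / (K * (m + 1)) with ht
    have ht0 : 0 < t := by positivity
    have htn : ‖(t : ℂ) • s‖ < ρ := by
      rw [norm_smul, Complex.norm_real, Real.norm_of_nonneg ht0.le]
      calc t * ‖s‖ ≤ t * (m * K) := by gcongr
        _ < t * (K * (m + 1)) := by gcongr 1; nlinarith
        _ = ρ := by rw [ht]; field_simp
    obtain ⟨hts, htC⟩ := hbound _ htn
    have h2 : t ^ m * ∑' i : Fin m → ι, ‖a m i‖ * ∏ j, ‖b.coord (i j) s‖ ≤ C := by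
      refine le_trans (le_of_eq ?_) ((tsum_le_tsum_words hts m).trans htC)
      rw [← tsum_mul_left]
      refine tsum_congr fun i => ?_
      rw [prod_norm_coord_smul, Complex.norm_real, Real.norm_of_nonneg ht0.le]
      ring
    exact h1.trans (le_exp_mul_pow_of_pow_mul_factorial_mul_le hK hρ hC m
      ((mul_le_mul_of_nonneg_left (factorial_mul_tsum_le ha (hs m) x) (by positivity)).trans h2))
  refine ⟨C * Real.exp 1, K * Real.exp 1 / ρ, by positivity, by positivity, fun m x => ?_⟩
  by_cases h0 : ∃ j, x j = 0
  · obtain ⟨j, hj⟩ := h0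
    rw [MultilinearMap.map_coord_zero _ j hj, norm_zero]
    positivity
  · push Not at h0
    have e : x = fun j => (‖x j‖ : ℂ) • ((‖x j‖ : ℂ)⁻¹ • x j) := by
      funext j
      rw [smul_smul, mul_inv_cancel₀ (by simpa using h0 j), one_smul]
    have := hunit m (fun j => (‖x j‖ : ℂ)⁻¹ • x j) fun j => by
      rw [norm_smul, norm_inv, Complex.norm_real, norm_norm,
        inv_mul_cancel₀ (norm_ne_zero_iff.2 (h0 j))]
    conv_lhs => rw [e]
    rw [MultilinearMap.map_smul_univ, norm_smul, norm_prod, mul_comm]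
    simp only [Complex.norm_real, norm_norm]
    exact mul_le_mul_of_nonneg_right this (by positivity)

/-- A function with an absolutely convergent expansion with symmetric coefficients is analytic,
and its power series consists of the forms with these coefficients. -/
theorem exists_hasFPowerSeriesAt [CompleteSpace E] (hs : ∀ m (σ : Equiv.Perm (Fin m)) i, a m (i ∘ σ) = a m i)
    {f : E → ℂ} {z : E}
    (h : ∀ᶠ v in 𝓝 (0 : E), Summable fun i : Σ m, Fin m → ι =>
      ‖a i.1 i.2‖ * ∏ j, ‖b.coord (i.2 j) v‖)
    (hf : ∀ᶠ v in 𝓝 (0 : E), HasSum (fun i : Σ m, Fin m → ι =>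
      a i.1 i.2 * ∏ j, b.coord (i.2 j) v) (f (z + v))) :
    ∃ p : FormalMultilinearSeries ℂ E ℂ, HasFPowerSeriesAt f p z ∧
      ∀ m, (p m).toMultilinearMap = seriesForm b (a m) (isAbsSummable_of_eventually h m) := by
  obtain ⟨C, R, hC, hR, hbound⟩ := exists_norm_seriesForm_le hs h
  let p : FormalMultilinearSeries ℂ E ℂ := fun m =>
    (seriesForm b (a m) (isAbsSummable_of_eventually h m)).mkContinuous (C * R ^ m) (hbound m)
  obtain ⟨r, hr, hball⟩ := Metric.eventually_nhds_iff.1 hf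
  have hrad : ((Real.toNNReal R⁻¹ : NNReal) : ENNReal) ≤ p.radius := by
    refine p.le_radius_of_bound C fun m => ?_
    rw [Real.coe_toNNReal _ (by positivity)]
    refine (mul_le_mul_of_nonneg_right (MultilinearMap.mkContinuous_norm_le _ (by positivity) _)
      (by positivity)).trans_eq ?_
    rw [inv_pow, mul_assoc, mul_inv_cancel₀ (by positivity), mul_one]
  -- `R⁻¹` bounds the radius of convergence from below, and within `r` the word series sums to `f`.
  refine ⟨p, ⟨min (Real.toNNReal R⁻¹ : NNReal) (ENNReal.ofReal r), (min_le_left _ _).trans hrad,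
    lt_min (by simpa using hR) (by simpa using hr), fun {v} hv => ?_⟩, fun m => rfl⟩
  have hvr : ‖v‖ < r := by
    have := (Metric.mem_eball.1 hv).trans_le (min_le_right _ _)
    rw [edist_zero_right, ← ofReal_norm, ENNReal.ofReal_lt_ofReal_iff hr] at this
    exact this
  have := hball (y := v) (by rwa [dist_zero_right])
  exact this.sigma fun m => hasSum_seriesForm b (a m) (isAbsSummable_of_eventually h m) fun _ => v

/-- The iterated derivative is the sum of `p m` over all permutations of its arguments; for
symmetric `p m` this is `m!` equal terms. -/
theorem taylorForm_eq_of_hasFPowerSeriesAt [CompleteSpace E] {p : FormalMultilinearSeries ℂ E ℂ} {f : E → ℂ} {z : E}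
    (hp : HasFPowerSeriesAt f p z) (hs : ∀ m (σ : Equiv.Perm (Fin m)) x, p m (x ∘ σ) = p m x)
    (m : ℕ) : taylorForm f z m = (p m).toMultilinearMap := by
  obtain ⟨r, hr⟩ := hp
  refine MultilinearMap.ext fun x => ?_
  show (m.factorial : ℂ)⁻¹ • iteratedFDeriv ℂ m f z x = p m x
  have e : ∀ σ : Equiv.Perm (Fin m), (p m fun j => x (σ j)) = p m x := fun σ => hs m σ x
  rw [hr.iteratedFDeriv_eq_sum_of_completeSpace, Finset.sum_congr rfl fun σ _ => e σ,
    Finset.sum_const, Finset.card_univ, Fintype.card_perm, Fintype.card_fin, nsmul_eq_mul,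
    smul_eq_mul, inv_mul_cancel_left₀ (Nat.cast_ne_zero.2 m.factorial_ne_zero)]

end words

/-! ### Words and multi-indices -/

/-- The multi-index counting the occurrences of each letter in a word. -/
noncomputable def wordExp (i : Σ m, Fin m → ι) : ι →₀ ℕ := ∑ j, Finsupp.single (i.2 j) 1

theorem wordExp_comp_perm {m : ℕ} (σ : Equiv.Perm (Fin m)) (i : Fin m → ι) :
    wordExp ⟨m, i ∘ σ⟩ = wordExp ⟨m, i⟩ :=
  Equiv.sum_comp σ fun j => Finsupp.single (i j) 1

theorem monomial_wordExp (b : UnconditionalSchauderBasis ι ℂ E) (i : Σ m, Fin m → ι) (v : E) :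
    monomial b (wordExp i) v = ∏ j, b.coord (i.2 j) v := by
  classical
  rw [monomial, wordExp, ← Finsupp.prod_finsetSum_index (fun _ => pow_zero _)
    fun _ _ _ => pow_add _ _ _]
  refine Finset.prod_congr rfl fun j _ => ?_
  exact (Finsupp.prod_single_index (h := fun k n => b.coord k v ^ n) (pow_zero _)).trans (pow_one _)

theorem degree_wordExp (i : Σ m, Fin m → ι) : (wordExp i).degree = i.1 := by
  rw [wordExp, map_sum]
  simp

theorem mem_support_wordExp (i : Σ m, Fin m → ι) (j : Fin i.1) : i.2 j ∈ (wordExp i).support := by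
  classical
  rw [Finsupp.mem_support_iff, wordExp, Finsupp.finsetSum_apply]
  refine (lt_of_lt_of_le one_pos ?_).ne'
  refine le_trans (by simp) (Finset.single_le_sum
    (f := fun k => (Finsupp.single (i.2 k) 1 : ι →₀ ℕ) (i.2 j)) (fun _ _ => Nat.zero_le _)
    (Finset.mem_univ j))

/-- Such a word has length the degree of `α` and letters in the support of `α`. -/
instance finite_wordExp_fiber (α : ι →₀ ℕ) : Finite {i : Σ m, Fin m → ι // wordExp i = α} := by
  refine Set.Finite.to_subtype (s := {i : Σ m, Fin m → ι | wordExp i = α})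
    ((Set.finite_range fun k : Fin α.degree → α.support =>
      (⟨α.degree, fun j => k j⟩ : Σ m, Fin m → ι)).subset ?_)
  rintro ⟨m, i⟩ rfl
  have hd := degree_wordExp ⟨m, i⟩
  refine ⟨fun j => ⟨i (Fin.cast hd j), mem_support_wordExp ⟨m, i⟩ _⟩, ?_⟩
  refine Sigma.ext hd ?_
  refine (Fin.heq_fun_iff hd).2 fun j => rfl

theorem wordExp_surjective : Function.Surjective (wordExp (ι := ι)) := by
  classical
  have key : ∀ s : Multiset ι, ∃ i : Σ m, Fin m → ι, wordExp i = Multiset.toFinsupp s := by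
    intro s
    induction s using Multiset.induction with
    | empty => exact ⟨⟨0, Fin.elim0⟩, by simp [wordExp]⟩
    | cons k s ih =>
      obtain ⟨⟨m, i⟩, hi⟩ := ih
      refine ⟨⟨m + 1, Fin.cons k i⟩, ?_⟩
      rw [← Multiset.singleton_add, map_add, Multiset.toFinsupp_singleton, ← hi]
      simp [wordExp, Fin.sum_univ_succ]
  intro α
  obtain ⟨i, hi⟩ := key (Finsupp.toMultiset α)
  exact ⟨i, by rw [hi, Finsupp.toMultiset_toFinsupp]⟩

theorem card_wordExp_fiber_ne_zero (α : ι →₀ ℕ) :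
    Nat.card {i : Σ m, Fin m → ι // wordExp i = α} ≠ 0 := by
  obtain ⟨i, hi⟩ := wordExp_surjective α
  have : Nonempty {i : Σ m, Fin m → ι // wordExp i = α} := ⟨⟨i, hi⟩⟩
  exact Nat.card_pos.ne'

/-- The symmetric coefficients of a monomial series. -/
noncomputable def symmCoeff (c : (ι →₀ ℕ) → ℂ) (m : ℕ) (i : Fin m → ι) : ℂ :=
  c (wordExp ⟨m, i⟩) / Nat.card {k : Σ m, Fin m → ι // wordExp k = wordExp ⟨m, i⟩}

theorem symmCoeff_comp_perm (c : (ι →₀ ℕ) → ℂ) (m : ℕ) (σ : Equiv.Perm (Fin m)) (i : Fin m → ι) :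
    symmCoeff c m (i ∘ σ) = symmCoeff c m i := by
  rw [symmCoeff, symmCoeff, wordExp_comp_perm]

theorem hasSum_symmCoeff_fiber (b : UnconditionalSchauderBasis ι ℂ E) (c : (ι →₀ ℕ) → ℂ) (v : E)
    (α : ι →₀ ℕ) : HasSum (fun i : {i : Σ m, Fin m → ι // wordExp i = α} =>
      symmCoeff c i.1.1 i.1.2 * ∏ j, b.coord (i.1.2 j) v) (c α * monomial b α v) := by
  have := Fintype.ofFinite {i : Σ m, Fin m → ι // wordExp i = α}
  have hN : (Nat.card {i : Σ m, Fin m → ι // wordExp i = α} : ℂ) ≠ 0 :=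
    Nat.cast_ne_zero.2 (card_wordExp_fiber_ne_zero α)
  convert hasSum_fintype _
  have e : ∀ i : {i : Σ m, Fin m → ι // wordExp i = α},
      symmCoeff c i.1.1 i.1.2 * ∏ j, b.coord (i.1.2 j) v
        = c α / Nat.card {i : Σ m, Fin m → ι // wordExp i = α} * monomial b α v := by
    rintro ⟨i, rfl⟩
    rw [symmCoeff, monomial_wordExp]
  rw [Finset.sum_congr rfl fun i _ => e i, Finset.sum_const, Finset.card_univ,
    ← Nat.card_eq_fintype_card, nsmul_eq_mul, ← mul_assoc, mul_div_cancel₀ _ hN]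

theorem summable_symmCoeff (b : UnconditionalSchauderBasis ι ℂ E) {c : (ι →₀ ℕ) → ℂ} {v : E}
    (h : Summable fun α => ‖c α * monomial b α v‖) :
    Summable fun i : Σ m, Fin m → ι =>
      ‖symmCoeff c i.1 i.2‖ * ∏ j, ‖b.coord (i.2 j) v‖ := by
  -- The shares of `c α` within a fibre are equal, so their norms add up without loss.
  have hc : ∀ α, HasSum (fun i : {i : Σ m, Fin m → ι // wordExp i = α} =>
      ‖symmCoeff c i.1.1 i.1.2‖ * ∏ j, ‖b.coord (i.1.2 j) v‖) ‖c α * monomial b α v‖ := by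
    intro α
    have := Fintype.ofFinite {i : Σ m, Fin m → ι // wordExp i = α}
    have hN : (Nat.card {i : Σ m, Fin m → ι // wordExp i = α} : ℝ) ≠ 0 :=
      Nat.cast_ne_zero.2 (card_wordExp_fiber_ne_zero α)
    convert hasSum_fintype _
    have e : ∀ i : {i : Σ m, Fin m → ι // wordExp i = α},
        ‖symmCoeff c i.1.1 i.1.2‖ * ∏ j, ‖b.coord (i.1.2 j) v‖
          = ‖c α * monomial b α v‖ / Nat.card {i : Σ m, Fin m → ι // wordExp i = α} := by
      rintro ⟨i, rfl⟩
      rw [symmCoeff, monomial_wordExp, norm_mul, norm_div, norm_prod, Complex.norm_natCast]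
      ring
    rw [Finset.sum_congr rfl fun i _ => e i, Finset.sum_const, Finset.card_univ,
      ← Nat.card_eq_fintype_card, nsmul_eq_mul, mul_div_cancel₀ _ hN]
  rw [← (Equiv.sigmaFiberEquiv (wordExp (ι := ι))).summable_iff]
  refine (summable_sigma_of_nonneg fun i => ?_).2 ⟨fun α => (hc α).summable, ?_⟩
  · exact mul_nonneg (norm_nonneg _) (Finset.prod_nonneg fun _ _ => norm_nonneg _)
  · exact h.congr fun α => (hc α).tsum_eq.symm

theorem summable_words_of_norm {b : UnconditionalSchauderBasis ι ℂ E}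
    {a : ∀ m : ℕ, (Fin m → ι) → ℂ} {v : E} (h : Summable fun i : Σ m, Fin m → ι =>
      ‖a i.1 i.2‖ * ∏ j, ‖b.coord (i.2 j) v‖) :
    Summable fun i : Σ m, Fin m → ι => a i.1 i.2 * ∏ j, b.coord (i.2 j) v :=
  Summable.of_norm (h.congr fun i => by rw [norm_mul, norm_prod])

theorem hasSum_symmCoeff (b : UnconditionalSchauderBasis ι ℂ E) {c : (ι →₀ ℕ) → ℂ} {v : E} {s : ℂ}
    (h : Summable fun α => ‖c α * monomial b α v‖)
    (hs : HasSum (fun α => c α * monomial b α v) s) :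
    HasSum (fun i : Σ m, Fin m → ι => symmCoeff c i.1 i.2 * ∏ j, b.coord (i.2 j) v) s := by
  have h1 := (summable_words_of_norm (summable_symmCoeff b h)).hasSum
  have h2 := ((Equiv.sigmaFiberEquiv (wordExp (ι := ι))).hasSum_iff.2 h1).sigma
    (hasSum_symmCoeff_fiber b c v)
  rwa [h2.unique hs] at h1

/-- Collecting the words with the same multi-index in an absolutely convergent series. -/
theorem hasSum_monomial_of_words (b : UnconditionalSchauderBasis ι ℂ E)
    {a : ∀ m : ℕ, (Fin m → ι) → ℂ} {v : E} {s : ℂ}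
    (h : Summable fun i : Σ m, Fin m → ι => ‖a i.1 i.2‖ * ∏ j, ‖b.coord (i.2 j) v‖)
    (hs : HasSum (fun i : Σ m, Fin m → ι => a i.1 i.2 * ∏ j, b.coord (i.2 j) v) s) :
    (Summable fun α : ι →₀ ℕ =>
      ‖(∑' i : {i : Σ m, Fin m → ι // wordExp i = α}, a i.1.1 i.1.2) * monomial b α v‖) ∧
    HasSum (fun α : ι →₀ ℕ =>
      (∑' i : {i : Σ m, Fin m → ι // wordExp i = α}, a i.1.1 i.1.2) * monomial b α v) s := by
  have e : ∀ α : ι →₀ ℕ,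
      (∑' i : {i : Σ m, Fin m → ι // wordExp i = α}, a i.1.1 i.1.2) * monomial b α v
        = ∑' i : {i : Σ m, Fin m → ι // wordExp i = α},
          a i.1.1 i.1.2 * ∏ j, b.coord (i.1.2 j) v := by
    intro α
    rw [← tsum_mul_right]
    refine tsum_congr ?_
    rintro ⟨i, rfl⟩
    rw [monomial_wordExp]
  simp only [e]
  have hn : Summable fun i : Σ m, Fin m → ι => ‖a i.1 i.2 * ∏ j, b.coord (i.2 j) v‖ :=
    h.congr fun i => by rw [norm_mul, norm_prod]
  have hn' := (Equiv.sigmaFiberEquiv (wordExp (ι := ι))).summable_iff.2 hn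
  have hs' := (Equiv.sigmaFiberEquiv (wordExp (ι := ι))).hasSum_iff.2 hs
  refine ⟨hn'.sigma.of_nonneg_of_le (fun _ => norm_nonneg _) fun α => ?_, ?_⟩
  · exact norm_tsum_le_tsum_norm (hn'.sigma_factor α)
  · exact hs'.sigma fun α => ((summable_words_of_norm h).subtype _).hasSum

/-! ### The two implications -/

theorem eventually_nhds_iff_add {E : Type*} [NormedAddCommGroup E] {z : E} {p : E → Prop} :
    (∀ᶠ w in 𝓝 z, p w) ↔ ∀ᶠ v in 𝓝 (0 : E), p (z + v) := by
  rw [← map_add_left_nhds_zero z, Filter.eventually_map]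

theorem taylorForm_comp_perm {f : E → ℂ} {z : E} (hf : AnalyticAt ℂ f z) (m : ℕ)
    (σ : Equiv.Perm (Fin m)) (x : Fin m → E) : taylorForm f z m (x ∘ σ) = taylorForm f z m x :=
  congrArg ((m.factorial : ℂ)⁻¹ • ·) (hf.contDiffAt.iteratedFDeriv_comp_perm x σ)

theorem continuous_taylorForm (f : E → ℂ) (z : E) (m : ℕ) : Continuous (taylorForm f z m) :=
  ((m.factorial : ℂ)⁻¹ • iteratedFDeriv ℂ m f z).cont

theorem eventually_hasSum_taylorForm {f : E → ℂ} {z : E} (hf : AnalyticAt ℂ f z) :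
    ∀ᶠ v in 𝓝 (0 : E), HasSum (fun m => taylorForm f z m fun _ => v) (f (z + v)) := by
  obtain ⟨p, r, hp⟩ := hf
  filter_upwards [Metric.eball_mem_nhds (0 : E) hp.r_pos] with v hv
  exact hp.hasSum_iteratedFDeriv hv

/-- Near a point, a regularly holomorphic function is the sum of a monomial expansion. -/
theorem RegularlyHolomorphicOn.hasAbsMonomialExpansionAt [CompleteSpace E]
    {b : UnconditionalSchauderBasis ι ℂ E} {f : E → ℂ} {U : Set E}
    (h : RegularlyHolomorphicOn b f U) {z : E} (hz : z ∈ U) : HasAbsMonomialExpansionAt b f z := by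
  have hf := h.holomorphic z hz
  have ha : ∀ m, IsAbsSummable b (coeff b (taylorForm f z m)) := fun m =>
    (h.regular z hz m).isAbsSummable
  have hc := continuous_taylorForm f z
  have hconv := eventually_nhds_iff_add.1 (h.convergent z hz)
  refine ⟨fun α => ∑' i : {i : Σ m, Fin m → ι // wordExp i = α},
    coeff b (taylorForm f z i.1.1) i.1.2, eventually_nhds_iff_add.2 ?_⟩
  filter_upwards [hconv, eventually_hasSum_taylorForm hf] with v hv hsum
  rw [add_sub_cancel_left] at hv ⊢
  rw [regularlyConvergentAt_iff (taylorForm_comp_perm hf) hc ha] at hv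
  have hw := (summable_words_of_norm (a := fun m => coeff b (taylorForm f z m)) hv).hasSum
  -- Summing the words by length recovers the Taylor series, which identifies the total with `f (z +
  -- v)`.
  have hw' := hw.sigma fun m => hasSum_coeff b (hc m) (ha m) fun _ => v
  rw [hw'.unique hsum] at hw
  exact hasSum_monomial_of_words b (a := fun m => coeff b (taylorForm f z m)) hv hw

/-- A function with absolutely convergent monomial expansions is regularly holomorphic. -/
theorem regularlyHolomorphicOn_of_hasAbsMonomialExpansionAt [CompleteSpace E]
    {b : UnconditionalSchauderBasis ι ℂ E} {f : E → ℂ} {U : Set E}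
    (h : ∀ z ∈ U, HasAbsMonomialExpansionAt b f z) : RegularlyHolomorphicOn b f U := by
  -- Once the Taylor coefficients are known to be the symmetrized `c`, regularity and regular
  -- convergence both follow from summability over words.
  have key : ∀ z ∈ U, ∃ c : (ι →₀ ℕ) → ℂ, AnalyticAt ℂ f z ∧
      (∀ᶠ v in 𝓝 (0 : E), Summable fun i : Σ m, Fin m → ι =>
        ‖symmCoeff c i.1 i.2‖ * ∏ j, ‖b.coord (i.2 j) v‖) ∧
      ∀ m, coeff b (taylorForm f z m) = symmCoeff c m := by
    intro z hz
    obtain ⟨c, hc⟩ := h z hz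
    rw [eventually_nhds_iff_add] at hc
    simp only [add_sub_cancel_left] at hc
    have hsum := hc.mono fun v hv => summable_symmCoeff b hv.1
    obtain ⟨p, hp, hpa⟩ := exists_hasFPowerSeriesAt (symmCoeff_comp_perm c) hsum
      (hc.mono fun v hv => hasSum_symmCoeff b hv.1 hv.2)
    refine ⟨c, hp.analyticAt, hsum, fun m => ?_⟩
    rw [taylorForm_eq_of_hasFPowerSeriesAt hp, hpa, coeff_seriesForm]
    intro m σ x
    have e : ∀ y, p m y = seriesForm b (symmCoeff c m) (isAbsSummable_of_eventually hsum m) y :=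
      DFunLike.congr_fun (hpa m)
    rw [e, e]
    exact seriesForm_comp_perm b _ _ (symmCoeff_comp_perm c m) σ x
  refine ⟨fun z hz => ?_, fun z hz m => ?_, fun z hz => ?_⟩
  · obtain ⟨c, hf, -⟩ := key z hz
    exact hf
  · obtain ⟨c, hf, hsum, hcoeff⟩ := key z hz
    refine isRegular_of_isAbsSummable (taylorForm_comp_perm hf m) (continuous_taylorForm f z m) ?_
    rw [hcoeff]
    exact isAbsSummable_of_eventually hsum m
  · obtain ⟨c, hf, hsum, hcoeff⟩ := key z hz
    refine eventually_nhds_iff_add.2 (hsum.mono fun v hv => ?_)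
    rw [add_sub_cancel_left, regularlyConvergentAt_iff (taylorForm_comp_perm hf)
      (continuous_taylorForm f z) fun m => by
        rw [hcoeff]; exact isAbsSummable_of_eventually hsum m]
    simpa only [hcoeff] using hv

end

end RegularHolomorphy

theorem theorem4p2 {ι E : Type*} [Countable ι]
    [NormedAddCommGroup E] [NormedSpace ℂ E] [CompleteSpace E]
    (b : UnconditionalSchauderBasis ι ℂ E)
    (U : Set E) (hU : IsOpen U) (f : E → ℂ) :
    RegularHolomorphy.RegularlyHolomorphicOn b f U ↔
      ∀ z ∈ U, RegularHolomorphy.HasAbsMonomialExpansionAt b f z :=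
  ⟨fun h _ hz => h.hasAbsMonomialExpansionAt hz,
    RegularHolomorphy.regularlyHolomorphicOn_of_hasAbsMonomialExpansionAt⟩
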